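/- Let $\mathbb{S}$ (states) and $\mathbb{U}$ (actions) be finite sets, let $\mathbb{F}\subseteq\mathbb{S}$ be a set of forbidden states, and let $\mathcal{Q}(\cdot,s,u)$ be, for every $(s,u)\in\mathbb{S}\times\mathbb{U}$, a probability mass function (pmf) on $\mathbb{S}$ (the law of the next state). A (memoryless) policy $\mathcal{K}$ assigns to each $s\in\mathbb{S}$ a pmf $\mathcal{K}(\cdot,s)$ on $\mathbb{U}$; under it the state $(S_k)_{k\ge0}$ is a Markov chain with transition probabilities $\mathcal{Q}_{\mathcal{K}}(s^+,s)=\sum_{u}\mathcal{Q}(s^+,s,u)\mathcal{K}(u,s)$, and $P_{\mathcal{K}}(\,\cdot\mid S_0=s)$ denotes its law when started at $s$. A state $s$ is recurrent under $\mathcal{K}$ if $P_{\mathcal{K}}(S_k=s\text{ for some }k>0\mid S_0=s)=1$, and it is $\mathbb{F}$-safe under $\mathcal{K}$ if $P_{\mathcal{K}}(S_k\in\mathbb{F}\text{ for some }k>0\mid S_0=s)=0$. Let $\mathbb{S}^R_{\mathcal{K},\mathbb{F}}$ be the set of states that are recurrent and $\mathbb{F}$-safe under $\mathcal{K}$, and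 let $\mathbb{S}^R_{\mathbb{F}}=\bigcup_{\mathcal{K}}\mathbb{S}^R_{\mathcal{K},\mathbb{F}}$, the union being over all policies. For $s_1\in\mathbb{S}$ let $\mathbb{S}^{ps}_{s_1,\mathcal{K},\mathbb{F}}$ be the set of those $s\in\mathbb{S}^R_{\mathcal{K},\mathbb{F}}$ with $P_{\mathcal{K}}(S_k=s\text{ for some }k>0\mid S_0=s_1)=1$. The sets $\mathbb{S}^{ps}_{s_1,\mathcal{K},\mathbb{F}}$ with $s_1\in\mathbb{S}^R_{\mathcal{K},\mathbb{F}}$ are called the recurrent classes of $\mathbb{S}^R_{\mathcal{K},\mathbb{F}}$. Let $f^*$ be a pmf on $\mathbb{S}\times\mathbb{U}$ that maximizes the entropy $-\sum_{s,u}f(s,u)\ln f(s,u)$ (with $0\ln 0=0$) among all pmfs $f$ on $\mathbb{S}\times\mathbb{U}$ such that $\sum_{u^+}f(s^+,u^+)=\sum_{s,u}\mathcal{Q}(s^+,s,u)f(s,u)$ for all $s^+\in\mathbb{S}$ and $\sum_u f(s,u)=0$ for all $s\in\mathbb{F}$. Put $f^*_S(s)=\sum_u f^*(s,u)$, and let $\mathcal{K}^*(u,s)=f^*(s,u)/f^*_S(s)$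 if $f^*_S(s)>0$ and $\mathcal{K}^*(u,s)=\mathcal{G}(u,s)$ otherwise, where $\mathcal{G}$ is any policy. Then the following hold. 1. If $\mathbb{S}^R_{\mathcal{K}^*,\mathbb{F}}$ has exactly one recurrent class, then for every $s_0\in\mathbb{S}^R_{\mathbb{F}}$, with probability one under $P_{\mathcal{K}^*}(\,\cdot\mid S_0=s_0)$, $$\lim_{k\to\infty}\frac1k\sum_{i=1}^k\mathbf{1}\{S_i=s,\ S_0=s_0\}=f^*_S(s)\qquad\text{for all }s\in\mathbb{S}.$$ 2. In general (any number of recurrent classes), every $s_0\in\mathbb{S}^R_{\mathbb{F}}$ lies in some recurrent class of $\mathbb{S}^R_{\mathcal{K}^*,\mathbb{F}}$, and for every recurrent class $C$ of $\mathbb{S}^R_{\mathcal{K}^*,\mathbb{F}}$ and every $s_0\in C$ we have $\beta=\sum_{s\in C}f^*_S(s)>0$ and, with probability one under $P_{\mathcal{K}^*}(\,\cdot\mid S_0=s_0)$, $$\lim_{k\to\infty}\frac1k\sum_{i=1}^k\mathbf{1}\{S_i=s,\ S_0=s_0\}=\begin{cases}f^*_S(s)/\beta,& s\in C,\\ 0,&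 s\notin C.\end{cases}$$ -/

import Mathlib

open MeasureTheory ProbabilityTheory Filter Topology
open scoped ENNReal

namespace Surveillance

variable {S U : Type*}

/-- The closed-loop transition probabilities `Q_K(s⁺, s) = ∑ u, Q(s⁺, s, u) K(u, s)`.
Here `Q s u` is the law of the next state given the current state `s` and the action `u`, and
the memoryless control policy `K` draws the action in state `s` from the law `K s`. -/
noncomputable def closedLoop (Q : S → U → PMF S) (K : S → PMF U) (s : S) : PMF S :=
  (K s).bind (Q s)

section PathLaw

variable [MeasurableSpace S] [DiscreteMeasurableSpace S]

/-- The one-step transition kernel of the Markov chain with transition probabilities `p`. -/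
noncomputable def stepKernel (p : S → PMF S) : Kernel S S where
  toFun s := (p s).toMeasure
  measurable' := Measurable.of_discrete

instance (p : S → PMF S) : IsMarkovKernel (stepKernel p) :=
  ⟨fun s => inferInstanceAs (IsProbabilityMeasure (p s).toMeasure)⟩

/-- The law, on the space of trajectories `ℕ → S`, of the time-homogeneous Markov chain with
transition probabilities `p` started at the state `s₀`; the state at time `k` of the trajectory
`ω` is `ω k`. -/
noncomputable def pathLaw (p : S → PMF S) (s₀ : S) : Measure (ℕ → S) :=
  Kernel.traj (X := fun _ : ℕ => S)
    (fun n => (stepKernel p).comap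
      (fun h : (Π _ : Finset.Iic n, S) => h ⟨n, Finset.mem_Iic.2 le_rfl⟩) (measurable_pi_apply _))
    0 (fun _ => s₀)

/-- The set of states that are recurrent under the policy `K`: a robot started at `s` revisits
`s` with probability one. -/
def recurrentStates (Q : S → U → PMF S) (K : S → PMF U) : Set S :=
  {s | pathLaw (closedLoop Q K) s {ω | ∃ k > 0, ω k = s} = 1}

/-- The set of states persistently surveilled under the policy `K` from the initial state `s₀`:
the recurrent states that are visited with probability one. -/
def surveilledStates (Q : S → U → PMF S) (K : S → PMF U) (s₀ : S) : Set S :=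
  {s | s ∈ recurrentStates Q K ∧ pathLaw (closedLoop Q K) s₀ {ω | ∃ k > 0, ω k = s} = 1}

/-- Under the policy `K`, a robot started at `s` has probability zero of ever moving into the
forbidden set `F`. -/
def IsSafe (Q : S → U → PMF S) (F : Set S) (K : S → PMF U) (s : S) : Prop :=
  pathLaw (closedLoop Q K) s {ω | ∃ k > 0, ω k ∈ F} = 0

/-- The set of `F`-safe recurrent states under the policy `K`. -/
def safeRecurrentStates (Q : S → U → PMF S) (F : Set S) (K : S → PMF U) : Set S :=
  {s | s ∈ recurrentStates Q K ∧ IsSafe Q F K s}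

/-- The maximal set of `F`-safe recurrent states: the union over all memoryless policies. -/
def maxSafeRecurrentStates (Q : S → U → PMF S) (F : Set S) : Set S :=
  ⋃ K : S → PMF U, safeRecurrentStates Q F K

/-- The set of `F`-safe persistently surveilled states under the policy `K` from `s₀`. -/
def safeSurveilledStates (Q : S → U → PMF S) (F : Set S) (K : S → PMF U) (s₀ : S) : Set S :=
  {s | s ∈ surveilledStates Q K s₀ ∧ IsSafe Q F K s}

/-- The `F`-safe recurrent classes under the policy `K`. -/
def safeRecurrentClasses (Q : S → U → PMF S) (F : Set S) (K : S → PMF U) : Set (Set S) :=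
  {C | ∃ s₁ ∈ safeRecurrentStates Q F K, C = safeSurveilledStates Q F K s₁}

end PathLaw

/-- The entropy `-∑ f ln f` of a probability mass function on state-action pairs (with
`0 ln 0 = 0`). -/
noncomputable def entropy [Fintype S] [Fintype U] (f : PMF (S × U)) : ℝ :=
  -∑ u, ∑ s, (f (s, u)).toReal * Real.log (f (s, u)).toReal

/-- The marginal `f_S(s) = ∑ u, f(s, u)` of `f` on the states. -/
noncomputable def marginal [Fintype U] (f : PMF (S × U)) (s : S) : ℝ≥0∞ := ∑ u, f (s, u)

/-- The mass `∑ s ∈ C, f_S(s)`. -/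
noncomputable def mass [Fintype S] [Fintype U] (f : PMF (S × U)) (C : Set S) : ℝ≥0∞ := ∑ s, C.indicator (marginal f) s

/-- The probability mass functions satisfying the invariance and the safety constraint of the
convex program. -/
def feasibleSet [Fintype S] [Fintype U] (Q : S → U → PMF S) (F : Set S) : Set (PMF (S × U)) :=
  {f | (∀ s', marginal f s' = ∑ s, ∑ u, Q s u s' * f (s, u)) ∧ ∀ s ∈ F, marginal f s = 0}

/-- `f` solves the convex program: it has maximal entropy among the feasible probability mass
functions. -/
def IsOptimal [Fintype S] [Fintype U] (Q : S → U → PMF S) (F : Set S) (f : PMF (S × U)) : Prop :=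
  f ∈ feasibleSet Q F ∧ ∀ g ∈ feasibleSet Q F, entropy g ≤ entropy f

theorem tsum_eq_marginal [Fintype U] (f : PMF (S × U)) (s : S) : ∑' u, f (s, u) = marginal f s :=
  tsum_fintype _

theorem marginal_ne_top [Fintype U] (f : PMF (S × U)) (s : S) : marginal f s ≠ ∞ :=
  ENNReal.sum_ne_top.2 fun _ _ => f.apply_ne_top _

open Classical in
/-- The policy `u ↦ f(s, u) / f_S(s)` at the states `s` with `f_S(s) > 0`, and an arbitrary
policy `G` elsewhere. -/
noncomputable def inducedPolicy [Fintype U] (f : PMF (S × U)) (G : S → PMF U) (s : S) : PMF U :=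
  if h : marginal f s = 0 then G s
  else PMF.normalize (fun u => f (s, u)) (by rwa [tsum_eq_marginal])
    (by rw [tsum_eq_marginal]; exact marginal_ne_top f s)

theorem inducedPolicy_of_pos [Fintype U] (f : PMF (S × U)) (G : S → PMF U) (s : S) (h : 0 < marginal f s)
    (u : U) : inducedPolicy f G s u = f (s, u) / marginal f s := by
  rw [inducedPolicy, dif_neg h.ne', PMF.normalize_apply, tsum_eq_marginal, div_eq_mul_inv]

theorem inducedPolicy_of_eq_zero [Fintype U] (f : PMF (S × U)) (G : S → PMF U) (s : S)
    (h : marginal f s = 0) : inducedPolicy f G s = G s := by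
  rw [inducedPolicy, dif_pos h]

/-- The proportion of the times `1, …, k` at which the trajectory `ω`, started at `s₀`, is in
the state `s`: `(1 / k) ∑ i = 1, …, k` of the indicator of `S_i = s, S_0 = s₀`. -/
noncomputable def timeAverage (s s₀ : S) (ω : ℕ → S) (k : ℕ) : ℝ :=
  (1 / (k : ℝ)) *
    ∑ i ∈ Finset.Icc 1 k, ({ω' : ℕ → S | ω' i = s ∧ ω' 0 = s₀}.indicator (fun _ => (1 : ℝ)) ω)

end Surveillance

/-! Maximal entropy forces maximal support. If `f x = 0` while a feasible `g` charges `x`, then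
replacing `f` by `(1 - t) f + t g` gains entropy of order `t log (1 / t)` at `x` and loses at most
order `t`, so `f` was not optimal (`IsOptimal.ne_zero`). A state that is recurrent and safe under
some policy carries an invariant distribution avoiding `F`; its state-action law is feasible, hence
`f_S > 0` there (`IsOptimal.marginal_ne_zero`). Conversely, `f_S` is stationary for the chain under
the induced policy, and a state charged by a stationary distribution is recurrent; the support is
closed and misses `F`, so the state is safe. Thus `{f_S > 0}` is both the safe recurrent set of the
induced policy and the maximal one, and the class of `s` is the closed irreducible set of states
reachable from `s`.

The ergodic theorem avoids return times. The visits to a state minus their conditional probabilities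
have second moment at most `k` after `k` steps, hence are almost surely `o(k)`. So every limit point
of the visit frequencies is a stationary distribution carried by the class. Only one exists, the
normalized restriction of `f_S` (`IsStationary.eq_div`), and compactness of the simplex gives
convergence. With a single class the normalizing mass is `1`. -/

namespace Surveillance

/-! ### The path law and its first-step decomposition. -/

section FirstStep

variable {S : Type*}

/-- The set of trajectories that agree with `a` up to time `n`. -/
def initialCylinder (n : ℕ) (a : ℕ → S) : Set (ℕ → S) := {ω | ∀ i ≤ n, ω i = a i}

/-- The trajectory that starts at `x` and continues with `ω`. -/
def consPath (x : S) (ω : ℕ → S) : ℕ → S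
  | 0 => x
  | n + 1 => ω n

@[simp] theorem consPath_zero (x : S) (ω : ℕ → S) : consPath x ω 0 = x := rfl

@[simp] theorem consPath_succ (x : S) (ω : ℕ → S) (n : ℕ) : consPath x ω (n + 1) = ω n := rfl

theorem consPath_mem_initialCylinder {x : S} {ω : ℕ → S} {n : ℕ} {a : ℕ → S} :
    consPath x ω ∈ initialCylinder (n + 1) a ↔
      a 0 = x ∧ ω ∈ initialCylinder n fun i => a (i + 1) := by
  constructor
  · intro h
    exact ⟨(h 0 (Nat.zero_le _)).symm, fun i hi => h (i + 1) (by omega)⟩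
  · rintro ⟨h0, h⟩ (_ | i) hi
    · exact h0.symm
    · exact h i (by omega)

theorem initialCylinder_eq_preimage (n : ℕ) (a : ℕ → S) :
    initialCylinder n a = Preorder.frestrictLe (π := fun _ => S) n ⁻¹'
      {Preorder.frestrictLe (π := fun _ => S) n a} := by
  ext ω
  simp [initialCylinder, funext_iff]

variable [MeasurableSpace S]

theorem measurable_consPath (x : S) : Measurable (consPath x) := by
  refine measurable_pi_iff.2 fun n => ?_
  cases n with
  | zero => exact measurable_const
  | succ n => exact measurable_pi_apply n

variable [DiscreteMeasurableSpace S]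

theorem measurableSet_initialCylinder (n : ℕ) (a : ℕ → S) :
    MeasurableSet (initialCylinder n a) := by
  have : initialCylinder n a = ⋂ i ≤ n, {ω : ℕ → S | ω i = a i} := by
    ext; simp [initialCylinder]
  rw [this]
  exact MeasurableSet.iInter fun i => MeasurableSet.iInter fun _ =>
    (measurable_pi_apply (X := fun _ : ℕ => S) i) (measurableSet_singleton (a i))

instance (p : S → PMF S) (x : S) : IsProbabilityMeasure (pathLaw p x) := by
  unfold pathLaw; infer_instance

theorem stepKernel_singleton (p : S → PMF S) (x y : S) : stepKernel p x {y} = p x y :=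
  (p x).toMeasure_apply_singleton y (MeasurableSet.of_discrete)

-- Apart from total mass one, this product formula is all that is used about the trajectory kernel.
open Classical in
theorem pathLaw_initialCylinder (p : S → PMF S) (x : S) (n : ℕ) (a : ℕ → S) :
    pathLaw p x (initialCylinder n a) =
      if a 0 = x then ∏ i ∈ Finset.range n, p (a i) (a (i + 1)) else 0 := by
  set κ : (n : ℕ) → Kernel (Π _ : Finset.Iic n, S) S := fun n => (stepKernel p).comap
      (fun h : (Π _ : Finset.Iic n, S) => h ⟨n, Finset.mem_Iic.2 le_rfl⟩) (measurable_pi_apply _)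
    with hκ
  have hcyl : ∀ n, initialCylinder n a = _ := fun n => initialCylinder_eq_preimage n a
  induction n with
  | zero =>
    have h := Kernel.traj_map_frestrictLe_apply (X := fun _ : ℕ => S) (κ := κ) 0 0 (fun _ => x)
    rw [Kernel.partialTraj_self, Kernel.id_apply] at h
    rw [hcyl, ← Measure.map_apply (Preorder.measurable_frestrictLe 0) (measurableSet_singleton _)]
    unfold pathLaw
    rw [h, Measure.dirac_apply' _ (measurableSet_singleton _)]
    by_cases hx : a 0 = x
    · simp [hx, Set.indicator, funext_iff]
    · simp [hx, Ne.symm hx, Set.indicator, funext_iff]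
  | succ n ih =>
    have h := Kernel.partialTraj_compProd_eq_map_traj (X := fun _ : ℕ => S) (κ := κ)
      (Nat.zero_le n) (x₀ := fun _ => x)
    have hset : initialCylinder (n + 1) a =
        (fun ω : ℕ → S => (Preorder.frestrictLe (π := fun _ => S) n ω, ω (n + 1))) ⁻¹'
          ({Preorder.frestrictLe (π := fun _ => S) n a} ×ˢ {a (n + 1)}) := by
      ext ω
      simp only [initialCylinder, Set.mem_ofPred_eq, Set.mem_preimage, Set.mem_prod,
        Set.mem_singleton_iff, funext_iff, Subtype.forall, Finset.mem_Iic,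
        Preorder.frestrictLe_apply]
      constructor
      · exact fun h => ⟨fun i hi => h i (by omega), h _ le_rfl⟩
      · rintro ⟨h1, h2⟩ i hi
        rcases Nat.lt_or_eq_of_le hi with h | rfl
        · exact h1 i (by omega)
        · exact h2
    have hms : MeasurableSet ({Preorder.frestrictLe (π := fun _ => S) n a} ×ˢ
        ({a (n + 1)} : Set S)) := (measurableSet_singleton _).prod (measurableSet_singleton _)
    have h1 : pathLaw p x (initialCylinder (n + 1) a) = p (a n) (a (n + 1)) *
        pathLaw p x (initialCylinder n a) := by
      rw [hset, hcyl n, ← Measure.map_apply (by fun_prop) hms,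
        ← Measure.map_apply (Preorder.measurable_frestrictLe n) (measurableSet_singleton _)]
      unfold pathLaw
      erw [← h]
      rw [Measure.compProd_apply_prod (measurableSet_singleton _) (measurableSet_singleton _),
        Kernel.traj_map_frestrictLe_apply, lintegral_singleton]
      congr 1
      exact stepKernel_singleton p _ _
    rw [h1, ih, Finset.prod_range_succ]
    split_ifs
    · rw [mul_comm]
    · simp

theorem ae_pathLaw_zero (p : S → PMF S) (x : S) : ∀ᵐ ω ∂pathLaw p x, ω 0 = x := by
  have h : pathLaw p x (initialCylinder 0 fun _ => x) = 1 := by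
    classical
    simp [pathLaw_initialCylinder]
  have := (prob_compl_eq_zero_iff (measurableSet_initialCylinder 0 fun _ => x)).2 h
  rw [ae_iff]
  convert this using 2
  ext ω
  simp [initialCylinder]

variable [Fintype S]

theorem measure_ext_of_initialCylinder {μ ν : Measure (ℕ → S)} [IsFiniteMeasure μ]
    (h : ∀ n a, μ (initialCylinder n a) = ν (initialCylinder n a)) : μ = ν := by
  have hproj : ∀ ρ : Measure (ℕ → S), ∀ I J : Finset ℕ, ∀ hIJ : J ⊆ I,
      (ρ.map I.restrict).map (Finset.restrict₂ (π := fun _ => S) hIJ) = ρ.map J.restrict := by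
    intro ρ I J hIJ
    rw [Measure.map_map (by fun_prop) (by fun_prop)]
    rfl
  have hμ : IsProjectiveLimit μ (fun I => μ.map I.restrict) := fun I => rfl
  refine hμ.unique ?_
  rw [isProjectiveLimit_nat_iff (fun I J hIJ => (hproj μ I J hIJ).symm)]
  intro n
  refine Measure.ext_of_singleton fun b => ?_
  have hb : ∃ a : ℕ → S, Preorder.frestrictLe (π := fun _ => S) n a = b := by
    -- The value after time `n` is irrelevant; taking it from `b` avoids assuming `S` nonempty.
    refine ⟨fun i => if hi : i ≤ n then b ⟨i, Finset.mem_Iic.2 hi⟩ else b ⟨0, by simp⟩, ?_⟩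
    ext ⟨i, hi⟩
    simp [Finset.mem_Iic.1 hi]
  obtain ⟨a, rfl⟩ := hb
  have hcyl : initialCylinder n a = _ := initialCylinder_eq_preimage n a
  rw [Measure.map_apply (Preorder.measurable_frestrictLe n) (measurableSet_singleton _), ← hcyl,
    ← h n a, hcyl]
  exact (Measure.map_apply (Preorder.measurable_frestrictLe n) (measurableSet_singleton _)).symm

/-- The Markov property at time `1`. -/
theorem pathLaw_firstStep (p : S → PMF S) (x : S) :
    pathLaw p x = ∑ y, p x y • (pathLaw p y).map (consPath x) := by
  classical
  refine measure_ext_of_initialCylinder fun n a => ?_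
  have hm : ∀ y, ((pathLaw p y).map (consPath x)) (initialCylinder n a) =
      pathLaw p y (consPath x ⁻¹' initialCylinder n a) := fun y =>
    Measure.map_apply (measurable_consPath x) (measurableSet_initialCylinder n a)
  simp only [Measure.coe_finsetSum, Finset.sum_apply, Measure.smul_apply, smul_eq_mul, hm]
  cases n with
  | zero =>
    by_cases hx : a 0 = x
    · have : consPath x ⁻¹' initialCylinder 0 a = Set.univ := by
        ext ω; simp [initialCylinder, hx]
      have hs : ∑ y, p x y = 1 := (tsum_fintype _).symm.trans (p x).tsum_coe
      simp [this, pathLaw_initialCylinder, hx, hs]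
    · have : consPath x ⁻¹' initialCylinder 0 a = ∅ := by
        ext ω; simp [initialCylinder, Ne.symm hx]
      simp [this, pathLaw_initialCylinder, hx]
  | succ n =>
    by_cases hx : a 0 = x
    · have : consPath x ⁻¹' initialCylinder (n + 1) a =
          initialCylinder n fun i => a (i + 1) := by
        ext ω; simp [consPath_mem_initialCylinder, hx]
      simp only [this, pathLaw_initialCylinder, hx, if_true, mul_ite, mul_zero,
        Finset.sum_ite_eq, Finset.mem_univ, Finset.prod_range_succ']
      rw [mul_comm]
    · have : consPath x ⁻¹' initialCylinder (n + 1) a = ∅ := by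
        ext ω; simp [consPath_mem_initialCylinder, hx]
      simp [this, pathLaw_initialCylinder, hx]

theorem pathLaw_apply (p : S → PMF S) (x : S) {A : Set (ℕ → S)} (hA : MeasurableSet A) :
    pathLaw p x A = ∑ y, p x y * pathLaw p y (consPath x ⁻¹' A) := by
  conv_lhs => rw [pathLaw_firstStep]
  simp [Finset.sum_apply, Measure.map_apply (measurable_consPath x) hA]

theorem integral_pathLaw (p : S → PMF S) (x : S) {g : (ℕ → S) → ℝ} (hg : Measurable g)
    {c : ℝ} (hb : ∀ ω, |g ω| ≤ c) :
    ∫ ω, g ω ∂pathLaw p x = ∑ y, (p x y).toReal * ∫ ω, g (consPath x ω) ∂pathLaw p y := by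
  conv_lhs => rw [pathLaw_firstStep]
  have hm : ∀ y, ∀ᵐ ω ∂((pathLaw p y).map (consPath x)), ‖g ω‖ ≤ c := fun y => .of_forall hb
  have : ∀ y, IsProbabilityMeasure ((pathLaw p y).map (consPath x)) := fun y =>
    Measure.isProbabilityMeasure_map (measurable_consPath x).aemeasurable
  rw [integral_finsetSum_measure]
  · refine Finset.sum_congr rfl fun y _ => ?_
    rw [integral_smul_measure, smul_eq_mul,
      integral_map (measurable_consPath x).aemeasurable hg.aestronglyMeasurable]
  · intro y _
    exact (Integrable.of_bound hg.aestronglyMeasurable c (hm y)).smul_measure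
      ((p x).apply_ne_top y)

end FirstStep

/-! ### Closed sets, reachability and hitting probabilities. -/

section Hitting

variable {S : Type*}

/-- A set of states that the chain with transition probabilities `p` cannot leave. -/
def IsClosedSet (p : S → PMF S) (B : Set S) : Prop := ∀ x ∈ B, ∀ y, p x y ≠ 0 → y ∈ B

/-- The state `y` can be reached from `x` in zero or more steps of positive probability. -/
def Reach (p : S → PMF S) (x y : S) : Prop := Relation.ReflTransGen (fun a b => p a b ≠ 0) x y

theorem isClosedSet_reach (p : S → PMF S) (x : S) : IsClosedSet p {y | Reach p x y} :=
  fun _ hy _ hz => Relation.ReflTransGen.tail hy hz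

theorem isClosedSet_not_reach (p : S → PMF S) (y : S) : IsClosedSet p {x | ¬ Reach p x y} :=
  fun _ hx _ hz h => hx (Relation.ReflTransGen.head hz h)

theorem IsClosedSet.mem_of_reach {p : S → PMF S} {B : Set S} (hB : IsClosedSet p B) {x y : S}
    (hx : x ∈ B) (h : Reach p x y) : y ∈ B := by
  induction h with
  | refl => exact hx
  | tail _ hyz ih => exact hB _ ih _ hyz

theorem exists_step (p : PMF S) : ∃ y, p y ≠ 0 := by
  obtain ⟨y, hy⟩ := p.support_nonempty
  exact ⟨y, (p.mem_support_iff y).1 hy⟩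

theorem sum_toReal_eq_one [Fintype S] (p : PMF S) : ∑ y, (p y).toReal = 1 := by
  rw [← ENNReal.toReal_sum fun y _ => p.apply_ne_top y, ← tsum_fintype (L := .unconditional S),
    p.tsum_coe, ENNReal.toReal_one]

theorem toReal_apply_eq_zero {p : PMF S} {y : S} : (p y).toReal = 0 ↔ p y = 0 := by
  simp [ENNReal.toReal_eq_zero_iff, p.apply_ne_top y]

variable [Fintype S] [MeasurableSpace S] [DiscreteMeasurableSpace S]

omit [Fintype S] in
theorem measurableSet_hit (A : Set S) : MeasurableSet {ω : ℕ → S | ∃ k > 0, ω k ∈ A} := by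
  have : {ω : ℕ → S | ∃ k > 0, ω k ∈ A} = ⋃ k > 0, {ω : ℕ → S | ω k ∈ A} := by
    ext; simp
  rw [this]
  exact MeasurableSet.iUnion fun i => MeasurableSet.iUnion fun _ =>
    (measurable_pi_apply (X := fun _ : ℕ => S) i) (MeasurableSet.of_discrete (s := A))

theorem IsClosedSet.ae_mem {p : S → PMF S} {B : Set S} (hB : IsClosedSet p B) {x : S}
    (hx : x ∈ B) : ∀ᵐ ω ∂pathLaw p x, ∀ k, ω k ∈ B := by
  rw [ae_all_iff]
  intro k
  induction k generalizing x with
  | zero =>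
    filter_upwards [ae_pathLaw_zero p x] with ω hω
    rwa [hω]
  | succ k ih =>
    have hm : MeasurableSet {ω : ℕ → S | ¬ ω (k + 1) ∈ B} :=
      (measurable_pi_apply (X := fun _ : ℕ => S) (k + 1)) (MeasurableSet.of_discrete (s := Bᶜ))
    rw [ae_iff, pathLaw_apply p x hm]
    refine Finset.sum_eq_zero fun y _ => ?_
    by_cases hy : p x y = 0
    · simp [hy]
    · have := ae_iff.1 (ih (hB x hx y hy))
      simp [this]

theorem IsClosedSet.hit_eq_zero {p : S → PMF S} {B A : Set S} (hB : IsClosedSet p B)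
    (hBA : Disjoint B A) {x : S} (hx : x ∈ B) :
    pathLaw p x {ω | ∃ k > 0, ω k ∈ A} = 0 := by
  have h : ∀ᵐ ω ∂pathLaw p x, ¬ ∃ k > 0, ω k ∈ A := by
    filter_upwards [hB.ae_mem hx] with ω hω
    rintro ⟨k, -, hk⟩
    exact Set.disjoint_left.1 hBA (hω k) hk
  simpa [ae_iff] using h

-- Time `0` of the shifted path is time `1` of the original one, so a first step into `A` already
-- counts as a hit.
open Classical in
theorem hit_firstStep (p : S → PMF S) (A : Set S) (x : S) :
    pathLaw p x {ω | ∃ k > 0, ω k ∈ A} =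
      ∑ y, p x y * if y ∈ A then 1 else pathLaw p y {ω | ∃ k > 0, ω k ∈ A} := by
  rw [pathLaw_apply p x (measurableSet_hit A)]
  refine Finset.sum_congr rfl fun y _ => ?_
  congr 1
  have hpre : consPath x ⁻¹' {ω | ∃ k > 0, ω k ∈ A} = {ω | ∃ k, ω k ∈ A} := by
    ext ω
    constructor
    · rintro ⟨_ | k, hk, h⟩
      · omega
      · exact ⟨k, h⟩
    · rintro ⟨k, h⟩
      exact ⟨k + 1, Nat.succ_pos k, h⟩
  rw [hpre]
  split_ifs with hy
  · have h : ∀ᵐ ω ∂pathLaw p y, ω ∈ {ω : ℕ → S | ∃ k, ω k ∈ A} := by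
      filter_upwards [ae_pathLaw_zero p y] with ω hω
      exact ⟨0, by rwa [hω]⟩
    exact (measure_congr (eventuallyEq_univ.2 h)).trans measure_univ
  · refine measure_congr ?_
    filter_upwards [ae_pathLaw_zero p y] with ω hω
    refine propext ⟨?_, fun ⟨k, _, h⟩ => ⟨k, h⟩⟩
    rintro ⟨_ | k, h⟩
    · rw [hω] at h; exact absurd h hy
    · exact ⟨k + 1, Nat.succ_pos k, h⟩

theorem hit_eq_zero_succ {p : S → PMF S} {A : Set S} {x y : S}
    (h : pathLaw p x {ω | ∃ k > 0, ω k ∈ A} = 0) (hy : p x y ≠ 0) :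
    y ∉ A ∧ pathLaw p y {ω | ∃ k > 0, ω k ∈ A} = 0 := by
  classical
  rw [hit_firstStep, Finset.sum_eq_zero_iff] at h
  have := (mul_eq_zero.1 (h y (Finset.mem_univ y))).resolve_left hy
  split_ifs at this with hA
  · exact absurd this one_ne_zero
  · exact ⟨hA, this⟩

/-- The probability that the chain started at `x` does not visit `z` at a positive time. -/
noncomputable def missProb (p : S → PMF S) (z x : S) : ℝ :=
  1 - (pathLaw p x).real {ω | ∃ k > 0, ω k = z}

omit [Fintype S] in
theorem missProb_nonneg (p : S → PMF S) (z x : S) : 0 ≤ missProb p z x :=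
  sub_nonneg.2 measureReal_le_one

omit [Fintype S] in
theorem missProb_eq_zero {p : S → PMF S} {z x : S} :
    missProb p z x = 0 ↔ pathLaw p x {ω | ∃ k > 0, ω k = z} = 1 := by
  rw [missProb, sub_eq_zero, eq_comm, measureReal_def, ENNReal.toReal_eq_one_iff]

open Classical in
theorem missProb_firstStep (p : S → PMF S) (z x : S) :
    missProb p z x = ∑ y, (p x y).toReal * if y = z then 0 else missProb p z y := by
  have h := hit_firstStep p {z} x
  simp only [Set.mem_singleton_iff] at h
  rw [missProb, measureReal_def, h, ENNReal.toReal_sum, ← sum_toReal_eq_one (p x),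
    ← Finset.sum_sub_distrib]
  · refine Finset.sum_congr rfl fun y _ => ?_
    rw [ENNReal.toReal_mul]
    split_ifs
    · simp
    · rw [missProb, measureReal_def]; ring
  · intro y _
    refine ENNReal.mul_ne_top ((p x).apply_ne_top y) ?_
    split_ifs
    · simp
    · exact measure_ne_top _ _

/-- The zero set of `missProb p x` is closed: a vanishing average of nonnegative terms vanishes
termwise, and the successor `x`, which the average ignores, is covered by `h`. -/
theorem missProb_eq_zero_of_reach {p : S → PMF S} {x y : S} (h : missProb p x x = 0)
    (hxy : Reach p x y) : missProb p x y = 0 := by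
  classical
  have hcl : IsClosedSet p {z | missProb p x z = 0} := by
    intro u hu v hv
    rw [Set.mem_ofPred_eq, missProb_firstStep, Finset.sum_eq_zero_iff_of_nonneg] at hu
    · have := (mul_eq_zero.1 (hu v (Finset.mem_univ v))).resolve_left
        (mt toReal_apply_eq_zero.1 hv)
      split_ifs at this with hvx
      · rwa [hvx]
      · exact this
    · intro w _
      refine mul_nonneg ENNReal.toReal_nonneg ?_
      split_ifs
      · exact le_rfl
      · exact missProb_nonneg p x w
  exact hcl.mem_of_reach h hxy

theorem reach_of_missProb_eq_zero {p : S → PMF S} {x y : S} (h : missProb p y x = 0) :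
    Reach p x y := by
  by_contra hxy
  have h0 := (isClosedSet_not_reach p y).hit_eq_zero (A := {y})
    (Set.disjoint_singleton_right.2 fun h => h .refl) hxy
  simp only [Set.mem_singleton_iff] at h0
  rw [missProb_eq_zero, h0] at h
  exact zero_ne_one h

/-- In a finite closed set all of whose states lead to `z`, the state `z` is hit almost surely. -/
theorem IsClosedSet.missProb_eq_zero {p : S → PMF S} {B : Set S} (hB : IsClosedSet p B) {z : S}
    (hz : ∀ x ∈ B, Reach p x z) {x : S} (hx : x ∈ B) : missProb p z x = 0 := by
  classical
  -- Maximum principle: if the maximum is positive, every successor of a maximizer is again a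
  -- maximizer and differs from `z`, so no maximizer can step to `z`.
  obtain ⟨m, hmB, hm⟩ := Set.exists_max_image B (missProb p z) (Set.toFinite B) ⟨x, hx⟩
  suffices h : missProb p z m = 0 from
    le_antisymm ((hm x hx).trans h.le) (missProb_nonneg p z x)
  by_contra hne
  have hpos : 0 < missProb p z m := (missProb_nonneg p z m).lt_of_ne' hne
  have hstep : ∀ u ∈ B, missProb p z u = missProb p z m → ∀ v, p u v ≠ 0 →
      v ≠ z ∧ missProb p z v = missProb p z m := by
    intro u hu hum v hv
    have hle : ∀ w ∈ Finset.univ, 0 ≤ (p u w).toReal *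
        (missProb p z m - if w = z then 0 else missProb p z w) := by
      intro w _
      by_cases hw : p u w = 0
      · simp [hw]
      · refine mul_nonneg ENNReal.toReal_nonneg (sub_nonneg.2 ?_)
        split_ifs
        · exact hpos.le
        · exact hm w (hB u hu w hw)
    have hsum : ∑ w, (p u w).toReal *
        (missProb p z m - if w = z then 0 else missProb p z w) = 0 := by
      simp_rw [mul_sub]
      rw [Finset.sum_sub_distrib, ← Finset.sum_mul, sum_toReal_eq_one, one_mul,
        ← missProb_firstStep, hum, sub_self]
    have := (mul_eq_zero.1 ((Finset.sum_eq_zero_iff_of_nonneg hle).1 hsum v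
      (Finset.mem_univ v))).resolve_left (mt toReal_apply_eq_zero.1 hv)
    split_ifs at this with hvz
    · exact absurd (by simpa using this) hne
    · exact ⟨hvz, (sub_eq_zero.1 this).symm⟩
  have hcl : IsClosedSet p {u | u ∈ B ∧ missProb p z u = missProb p z m} :=
    fun u hu v hv => ⟨hB u hu.1 v hv, (hstep u hu.1 hu.2 v hv).2⟩
  -- The maximizer `m` may be `z` itself. After one step `v ≠ z`, so a path from `v` to `z` has a
  -- last step.
  obtain ⟨v, hv⟩ := exists_step (p m)
  have hv' := hcl m ⟨hmB, rfl⟩ v hv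
  have hvz := (hstep m hmB rfl v hv).1
  rcases Relation.ReflTransGen.cases_tail (hz v hv'.1) with h | ⟨w, hw, hwz⟩
  · exact hvz h.symm
  · have hw' := hcl.mem_of_reach hv' hw
    exact (hstep w hw'.1 hw'.2 z hwz).1 rfl

end Hitting

/-! ### A strong law for compensated visit counts. -/

section Martingale

variable {S : Type*}

open Classical in
/-- The compensated number of visits to `s` during the times `1, …, k`. -/
noncomputable def compensatedVisits (p : S → PMF S) (s : S) (k : ℕ) (ω : ℕ → S) : ℝ :=
  ∑ i ∈ Finset.range k, ((if ω (i + 1) = s then 1 else 0) - (p (ω i) s).toReal)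

open Classical in
theorem abs_visit_sub_le (p : PMF S) (s y : S) :
    |(if y = s then (1 : ℝ) else 0) - (p s).toReal| ≤ 1 := by
  have h0 : 0 ≤ (p s).toReal := ENNReal.toReal_nonneg
  have h1 : (p s).toReal ≤ 1 := by
    simpa using ENNReal.toReal_mono ENNReal.one_ne_top (p.coe_le_one s)
  rw [abs_le]
  split_ifs <;> constructor <;> linarith

theorem abs_compensatedVisits_sub_le (p : S → PMF S) (s : S) (ω : ℕ → S) (m k : ℕ) :
    |compensatedVisits p s (m + k) ω - compensatedVisits p s m ω| ≤ k := by
  rw [compensatedVisits, compensatedVisits, Finset.sum_range_add, add_sub_cancel_left]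
  refine (Finset.abs_sum_le_sum_abs _ _).trans
    ((Finset.sum_le_sum fun i _ => abs_visit_sub_le _ _ _).trans ?_)
  simp

theorem abs_compensatedVisits_le (p : S → PMF S) (s : S) (k : ℕ) (ω : ℕ → S) :
    |compensatedVisits p s k ω| ≤ k := by
  simpa [compensatedVisits] using abs_compensatedVisits_sub_le p s ω 0 k

open Classical in
theorem compensatedVisits_consPath (p : S → PMF S) (s : S) (k : ℕ) (x : S) (ω : ℕ → S) :
    compensatedVisits p s (k + 1) (consPath x ω) =
      ((if ω 0 = s then 1 else 0) - (p x s).toReal) + compensatedVisits p s k ω := by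
  rw [compensatedVisits, Finset.sum_range_succ', add_comm]
  rfl

theorem sq_compensatedVisits_le (p : S → PMF S) (s : S) (k : ℕ) (ω : ℕ → S) :
    |compensatedVisits p s k ω ^ 2| ≤ (k : ℝ) ^ 2 := by
  rw [abs_pow]
  exact pow_le_pow_left₀ (abs_nonneg _) (abs_compensatedVisits_le p s k ω) 2

variable [MeasurableSpace S] [DiscreteMeasurableSpace S]

theorem measurable_compensatedVisits (p : S → PMF S) (s : S) (k : ℕ) :
    Measurable (compensatedVisits p s k) := by
  classical
  refine Finset.measurable_fun_sum _ fun i _ => Measurable.sub ?_ ?_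
  · exact (Measurable.of_discrete (f := fun y : S => if y = s then (1 : ℝ) else 0)).comp
      (measurable_pi_apply (X := fun _ : ℕ => S) (i + 1))
  · exact (Measurable.of_discrete (f := fun y : S => (p y s).toReal)).comp
      (measurable_pi_apply (X := fun _ : ℕ => S) i)

theorem integrable_compensatedVisits (p : S → PMF S) (s : S) (k : ℕ) (x : S) :
    Integrable (compensatedVisits p s k) (pathLaw p x) :=
  .of_bound (measurable_compensatedVisits p s k).aestronglyMeasurable k
    (.of_forall (abs_compensatedVisits_le p s k))

theorem integrable_sq_compensatedVisits (p : S → PMF S) (s : S) (k : ℕ) (x : S) :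
    Integrable (fun ω => compensatedVisits p s k ω ^ 2) (pathLaw p x) :=
  .of_bound ((measurable_compensatedVisits p s k).pow_const 2).aestronglyMeasurable _
    (.of_forall (sq_compensatedVisits_le p s k))

variable [Fintype S]

theorem integral_compensatedVisits (p : S → PMF S) (s : S) (k : ℕ) (x : S) :
    ∫ ω, compensatedVisits p s k ω ∂pathLaw p x = 0 := by
  classical
  induction k generalizing x with
  | zero => simp [compensatedVisits]
  | succ k ih =>
    rw [integral_pathLaw p x (measurable_compensatedVisits p s (k + 1))
      (abs_compensatedVisits_le p s (k + 1))]
    have h : ∀ y, ∫ ω, compensatedVisits p s (k + 1) (consPath x ω) ∂pathLaw p y =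
        (if y = s then 1 else 0) - (p x s).toReal := by
      intro y
      calc _ = ∫ ω, (((if y = s then 1 else 0) - (p x s).toReal) + compensatedVisits p s k ω)
            ∂pathLaw p y := by
            refine integral_congr_ae ?_
            filter_upwards [ae_pathLaw_zero p y] with ω hω
            rw [compensatedVisits_consPath, hω]
        _ = _ := by
            rw [integral_add (integrable_const _) (integrable_compensatedVisits p s k y), ih]
            simp
    simp_rw [h, mul_sub]
    rw [Finset.sum_sub_distrib, ← Finset.sum_mul, sum_toReal_eq_one]
    simp

/-- Splitting off the first increment `c` and expanding the square, the cross term vanishes because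
the remaining sum has mean zero from every starting state, and `c ^ 2 ≤ 1`. -/
theorem integral_sq_compensatedVisits_le (p : S → PMF S) (s : S) (k : ℕ) (x : S) :
    ∫ ω, compensatedVisits p s k ω ^ 2 ∂pathLaw p x ≤ k := by
  classical
  induction k generalizing x with
  | zero => simp [compensatedVisits]
  | succ k ih =>
    rw [integral_pathLaw p x ((measurable_compensatedVisits p s (k + 1)).pow_const 2)
      (sq_compensatedVisits_le p s (k + 1))]
    have h : ∀ y, ∫ ω, compensatedVisits p s (k + 1) (consPath x ω) ^ 2 ∂pathLaw p y ≤
        1 + k := by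
      intro y
      set c : ℝ := (if y = s then 1 else 0) - (p x s).toReal with hc
      have hc1 : c ^ 2 ≤ 1 := (sq_le_one_iff_abs_le_one c).2 (abs_visit_sub_le (p x) s y)
      calc _ = ∫ ω, (c ^ 2 + 2 * c * compensatedVisits p s k ω + compensatedVisits p s k ω ^ 2)
            ∂pathLaw p y := by
            refine integral_congr_ae ?_
            filter_upwards [ae_pathLaw_zero p y] with ω hω
            rw [compensatedVisits_consPath, hω]
            ring
        _ = c ^ 2 + ∫ ω, compensatedVisits p s k ω ^ 2 ∂pathLaw p y := by
            have hlin : Integrable (fun ω => c ^ 2 + 2 * c * compensatedVisits p s k ω)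
                (pathLaw p y) :=
              (integrable_const _).add ((integrable_compensatedVisits p s k y).const_mul _)
            rw [integral_add hlin (integrable_sq_compensatedVisits p s k y),
              integral_add (integrable_const _)
                ((integrable_compensatedVisits p s k y).const_mul _),
              integral_const_mul, integral_compensatedVisits]
            simp
        _ ≤ 1 + k := add_le_add hc1 (ih y)
    calc _ ≤ ∑ y, (p x y).toReal * (1 + k) :=
          Finset.sum_le_sum fun y _ => mul_le_mul_of_nonneg_left (h y) ENNReal.toReal_nonneg
      _ = _ := by
          rw [← Finset.sum_mul, sum_toReal_eq_one]
          push_cast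
          ring

/-- Along the squares the expectations are at most `1 / n ^ 2`, which is summable, so the series of
these terms is almost surely finite. -/
theorem ae_tendsto_compensatedVisits_sq (p : S → PMF S) (s x : S) :
    ∀ᵐ ω ∂pathLaw p x, Tendsto
      (fun n : ℕ => (compensatedVisits p s (n ^ 2) ω / ((n ^ 2 : ℕ) : ℝ)) ^ 2) atTop (𝓝 0) := by
  set g : ℕ → (ℕ → S) → ℝ :=
    fun n ω => (compensatedVisits p s (n ^ 2) ω / ((n ^ 2 : ℕ) : ℝ)) ^ 2 with hg
  have hgm : ∀ n, Measurable (g n) := fun n =>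
    ((measurable_compensatedVisits p s (n ^ 2)).div_const _).pow_const 2
  have hint : ∀ n, ∫⁻ ω, ENNReal.ofReal (g n ω) ∂pathLaw p x ≤
      ENNReal.ofReal (1 / (n : ℝ) ^ 2) := by
    intro n
    rw [← ofReal_integral_eq_lintegral_ofReal]
    · refine ENNReal.ofReal_le_ofReal ?_
      simp_rw [hg, div_pow]
      rw [integral_div]
      rcases Nat.eq_zero_or_pos n with rfl | hn
      · simp
      have hn' : (0 : ℝ) < n := by exact_mod_cast hn
      rw [div_le_div_iff₀ (by positivity) (by positivity)]
      have := integral_sq_compensatedVisits_le p s (n ^ 2) x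
      push_cast at this ⊢
      nlinarith [sq_nonneg (n : ℝ)]
    · simp_rw [hg, div_pow]
      exact (integrable_sq_compensatedVisits p s (n ^ 2) x).div_const _
    · exact .of_forall fun ω => sq_nonneg _
  have hsum : ∫⁻ ω, ∑' n, ENNReal.ofReal (g n ω) ∂pathLaw p x ≠ ∞ := by
    rw [lintegral_tsum fun n => (hgm n).ennreal_ofReal.aemeasurable]
    refine ne_top_of_le_ne_top ?_ (ENNReal.tsum_le_tsum hint)
    exact (Real.summable_one_div_nat_pow.2 one_lt_two).tsum_ofReal_ne_top
  filter_upwards [ae_lt_top (Measurable.tsum fun n => (hgm n).ennreal_ofReal) hsum]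
    with ω hω
  have h := ENNReal.tendsto_atTop_zero_of_tsum_ne_top hω.ne
  have h2 := (ENNReal.tendsto_toReal ENNReal.zero_ne_top).comp h
  refine h2.congr fun n => ?_
  exact ENNReal.toReal_ofReal (sq_nonneg _)

/-- The strong law of large numbers for the compensated visits. -/
theorem ae_tendsto_compensatedVisits_div (p : S → PMF S) (s x : S) :
    ∀ᵐ ω ∂pathLaw p x, Tendsto
      (fun k : ℕ => compensatedVisits p s k ω / (k : ℝ)) atTop (𝓝 0) := by
  filter_upwards [ae_tendsto_compensatedVisits_sq p s x] with ω hω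
  -- With `n = Nat.sqrt k`, at most `2 * n` increments of size at most `1` separate `k` from `n ^
  -- 2`; dividing by `n ^ 2` gives the error `2 / n`.
  have h1 : Tendsto (fun n : ℕ => |compensatedVisits p s (n ^ 2) ω / ((n ^ 2 : ℕ) : ℝ)| +
      2 / (n : ℝ)) atTop (𝓝 0) := by
    have h2 := hω.sqrt
    simp_rw [Real.sqrt_sq_eq_abs] at h2
    rw [Real.sqrt_zero] at h2
    simpa using h2.add (tendsto_const_div_atTop_nhds_zero_nat (2 : ℝ))
  have hsqrt : Tendsto Nat.sqrt atTop atTop := by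
    refine tendsto_atTop.2 fun b => ?_
    filter_upwards [eventually_ge_atTop (b * b)] with k hk using Nat.le_sqrt.2 hk
  refine squeeze_zero_norm' ?_ (h1.comp hsqrt)
  filter_upwards [eventually_ge_atTop 1] with k hk
  simp only [Function.comp_apply]
  set n := Nat.sqrt k with hn
  have hn1 : 1 ≤ n := Nat.le_sqrt.2 (by simpa using hk)
  have hnk : n ^ 2 ≤ k := by rw [sq]; exact Nat.sqrt_le k
  have hkn : k - n ^ 2 ≤ 2 * n := by
    have := Nat.sqrt_le_add k
    rw [← hn] at this
    rw [sq]; omega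
  have hd := abs_compensatedVisits_sub_le p s ω (n ^ 2) (k - n ^ 2)
  rw [Nat.add_sub_cancel' hnk] at hd
  have hd2 : |compensatedVisits p s k ω| ≤ |compensatedVisits p s (n ^ 2) ω| + 2 * n := by
    have h3 : ((k - n ^ 2 : ℕ) : ℝ) ≤ 2 * n := by exact_mod_cast hkn
    have h4 := abs_sub_abs_le_abs_sub (compensatedVisits p s k ω)
      (compensatedVisits p s (n ^ 2) ω)
    linarith
  have hn0 : (0 : ℝ) < n := by exact_mod_cast hn1
  have hnk' : (n : ℝ) ^ 2 ≤ k := by exact_mod_cast hnk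
  rw [Real.norm_eq_abs, abs_div, abs_div, Nat.abs_cast, Nat.abs_cast]
  calc |compensatedVisits p s k ω| / k
      ≤ (|compensatedVisits p s (n ^ 2) ω| + 2 * n) / (n : ℝ) ^ 2 :=
        div_le_div₀ (by positivity) hd2 (by positivity) hnk'
    _ = _ := by
        push_cast
        field_simp

end Martingale

/-! ### Stationary distributions and the ergodic theorem. -/

section Ergodic

variable {S : Type*}

open Classical in
/-- The proportion of the times `1, …, k` at which the trajectory `ω` is in the state `s`. -/
noncomputable def visitFreq (ω : ℕ → S) (k : ℕ) (s : S) : ℝ :=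
  (∑ i ∈ Finset.range k, if ω (i + 1) = s then (1 : ℝ) else 0) / k

theorem timeAverage_eq_visitFreq {ω : ℕ → S} {s₀ : S} (h : ω 0 = s₀) (s : S) (k : ℕ) :
    timeAverage s s₀ ω k = visitFreq ω k s := by
  classical
  rw [timeAverage, visitFreq, one_div, inv_mul_eq_div]
  congr 1
  induction k with
  | zero => simp
  | succ k ih =>
    rw [Finset.sum_Icc_succ_top (by omega), ih, Finset.sum_range_succ]
    simp [Set.indicator, h]

/-- `x` is an invariant distribution of the chain with transition probabilities `p`. -/
structure IsStationary [Fintype S] (p : S → PMF S) (x : S → ℝ) : Prop where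
  nonneg : ∀ s, 0 ≤ x s
  sum_eq_one : ∑ s, x s = 1
  invariant : ∀ t, ∑ s, x s * (p s t).toReal = x t

theorem visitFreq_nonneg (ω : ℕ → S) (k : ℕ) (s : S) : 0 ≤ visitFreq ω k s := by
  classical
  refine div_nonneg (Finset.sum_nonneg fun i _ => ?_) k.cast_nonneg
  split_ifs
  · exact zero_le_one
  · exact le_rfl

theorem visitFreq_eq_zero {ω : ℕ → S} {B : Set S} (hB : ∀ k, ω k ∈ B) (k : ℕ) {s : S}
    (hs : s ∉ B) : visitFreq ω k s = 0 := by
  classical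
  rw [visitFreq, Finset.sum_eq_zero, zero_div]
  intro i _
  rw [if_neg]
  rintro rfl
  exact hs (hB _)

variable [Fintype S]

theorem sum_visitFreq (ω : ℕ → S) {k : ℕ} (hk : k ≠ 0) : ∑ s, visitFreq ω k s = 1 := by
  classical
  simp_rw [visitFreq]
  rw [← Finset.sum_div, Finset.sum_comm]
  simp [hk]

/-- The sum on the left averages `p (ω i) t` over `i = 1, …, k`, the compensator over `i = 0, …, k -
1`; the shift leaves two boundary terms. -/
theorem visitFreq_sub_invariant (p : S → PMF S) (ω : ℕ → S) (k : ℕ) (t : S) :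
    visitFreq ω k t - ∑ s, visitFreq ω k s * (p s t).toReal =
      compensatedVisits p t k ω / k + ((p (ω 0) t).toReal - (p (ω k) t).toReal) / k := by
  classical
  have h1 : ∑ s, visitFreq ω k s * (p s t).toReal =
      (∑ i ∈ Finset.range k, (p (ω (i + 1)) t).toReal) / k := by
    simp_rw [visitFreq, div_mul_eq_mul_div, Finset.sum_mul]
    rw [← Finset.sum_div, Finset.sum_comm]
    simp
  have h2 : ∑ i ∈ Finset.range k, (p (ω (i + 1)) t).toReal + (p (ω 0) t).toReal =
      ∑ i ∈ Finset.range k, (p (ω i) t).toReal + (p (ω k) t).toReal := by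
    rw [← Finset.sum_range_succ' fun i => (p (ω i) t).toReal, Finset.sum_range_succ]
  rw [h1, visitFreq, compensatedVisits, Finset.sum_sub_distrib, ← sub_div, ← add_div]
  congr 1
  linarith

theorem tendsto_visitFreq_sub_invariant {p : S → PMF S} {ω : ℕ → S} {t : S}
    (h : Tendsto (fun k : ℕ => compensatedVisits p t k ω / (k : ℝ)) atTop (𝓝 0)) :
    Tendsto (fun k => visitFreq ω k t - ∑ s, visitFreq ω k s * (p s t).toReal) atTop (𝓝 0) := by
  have h1 : Tendsto (fun k : ℕ => ((p (ω 0) t).toReal - (p (ω k) t).toReal) / (k : ℝ)) atTop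
      (𝓝 0) := by
    refine squeeze_zero_norm (fun k => ?_) (tendsto_const_div_atTop_nhds_zero_nat (1 : ℝ))
    rw [norm_div, Real.norm_eq_abs, Real.norm_natCast]
    refine div_le_div_of_nonneg_right ?_ k.cast_nonneg
    have hp : ∀ z, 0 ≤ (p z t).toReal ∧ (p z t).toReal ≤ 1 := fun z =>
      ⟨ENNReal.toReal_nonneg,
        by simpa using ENNReal.toReal_mono ENNReal.one_ne_top ((p z).coe_le_one t)⟩
    have := hp (ω 0)
    have := hp (ω k)
    rw [abs_le]
    constructor <;> linarith
  simp_rw [visitFreq_sub_invariant]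
  simpa using h.add h1

/-- A limit point of the visit frequencies along a typical trajectory is stationary. -/
theorem isStationary_of_tendsto {p : S → PMF S} {ω : ℕ → S} {B : Set S} (hB : ∀ k, ω k ∈ B)
    (h : ∀ t, Tendsto (fun k : ℕ => compensatedVisits p t k ω / (k : ℝ)) atTop (𝓝 0))
    {l : Filter ℕ} [l.NeBot] (hl : l ≤ atTop) {x : S → ℝ} (hx : Tendsto (visitFreq ω) l (𝓝 x)) :
    IsStationary p x ∧ ∀ s ∉ B, x s = 0 := by
  rw [tendsto_pi_nhds] at hx
  refine ⟨⟨fun s => ge_of_tendsto' (hx s) fun k => visitFreq_nonneg ω k s, ?_, fun t => ?_⟩,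
    fun s hs => ?_⟩
  · refine tendsto_nhds_unique (tendsto_finsetSum _ fun s _ => hx s)
      (tendsto_const_nhds.congr' ?_)
    filter_upwards [hl (eventually_ge_atTop 1)] with k hk
    exact (sum_visitFreq ω (by omega)).symm
  · have h1 := (tendsto_visitFreq_sub_invariant (h t)).mono_left hl
    have h2 := (hx t).sub (tendsto_finsetSum Finset.univ
      fun s _ => (hx s).mul_const ((p s t).toReal))
    exact (sub_eq_zero.1 (tendsto_nhds_unique h2 h1)).symm
  · exact tendsto_nhds_unique (hx s)
      (tendsto_const_nhds.congr fun k => (visitFreq_eq_zero hB k hs).symm)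

theorem visitFreq_mem_stdSimplex (ω : ℕ → S) {k : ℕ} (hk : k ≠ 0) :
    visitFreq ω k ∈ stdSimplex ℝ S := ⟨visitFreq_nonneg ω k, sum_visitFreq ω hk⟩

theorem tendsto_visitFreq_of_unique {p : S → PMF S} {ω : ℕ → S} {B : Set S} (hB : ∀ k, ω k ∈ B)
    (h : ∀ t, Tendsto (fun k : ℕ => compensatedVisits p t k ω / (k : ℝ)) atTop (𝓝 0))
    {x : S → ℝ} (hx : ∀ y, IsStationary p y → (∀ s ∉ B, y s = 0) → y = x) :
    Tendsto (visitFreq ω) atTop (𝓝 x) := by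
  refine (isCompact_stdSimplex ℝ S).tendsto_nhds_of_unique_mapClusterPt
    ?_ fun y _ hy => ?_
  · filter_upwards [eventually_ge_atTop 1] with k hk
    exact visitFreq_mem_stdSimplex ω (by omega)
  · obtain ⟨U, hU, hy⟩ := mapClusterPt_iff_ultrafilter.1 hy
    have := isStationary_of_tendsto hB h hU hy
    exact hx y this.1 this.2

theorem IsStationary.ne_zero_of_step {p : S → PMF S} {x : S → ℝ} (hx : IsStationary p x)
    {s t : S} (hs : x s ≠ 0) (hst : p s t ≠ 0) : x t ≠ 0 := by
  rw [← hx.invariant t]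
  refine (Finset.sum_pos' (fun z _ => mul_nonneg (hx.nonneg z) ENNReal.toReal_nonneg)
    ⟨s, Finset.mem_univ s, ?_⟩).ne'
  exact mul_pos ((hx.nonneg s).lt_of_ne' hs)
    (ENNReal.toReal_nonneg.lt_of_ne' (mt toReal_apply_eq_zero.1 hst))

theorem IsStationary.isClosedSet_support {p : S → PMF S} {x : S → ℝ} (hx : IsStationary p x) :
    IsClosedSet p {s | x s ≠ 0} := fun _ hs _ hst => hx.ne_zero_of_step hs hst

theorem IsStationary.exists_ne_zero {p : S → PMF S} {x : S → ℝ} (hx : IsStationary p x) :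
    ∃ s, x s ≠ 0 := by
  by_contra! h
  have := hx.sum_eq_one
  simp [h] at this

/-- The restriction of an invariant vector to a closed set is invariant. -/
theorem IsStationary.indicator_invariant {p : S → PMF S} {x : S → ℝ} (hx : IsStationary p x)
    {C : Set S} (hC : IsClosedSet p C) (t : S) :
    ∑ s, C.indicator x s * (p s t).toReal = C.indicator x t := by
  classical
  have hnn : ∀ s, 0 ≤ C.indicator x s := Set.indicator_nonneg fun s _ => hx.nonneg s
  have hle : ∀ t ∈ Finset.univ, ∑ s, C.indicator x s * (p s t).toReal ≤ C.indicator x t := by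
    intro t _
    by_cases ht : t ∈ C
    · rw [Set.indicator_of_mem ht, ← hx.invariant t]
      exact Finset.sum_le_sum fun s _ => mul_le_mul_of_nonneg_right
        (Set.indicator_le_self' (fun s _ => hx.nonneg s) s) ENNReal.toReal_nonneg
    · rw [Set.indicator_of_notMem ht]
      refine (Finset.sum_eq_zero fun s _ => ?_).le
      by_cases hs : s ∈ C
      · have : p s t = 0 := by
          by_contra h
          exact ht (hC s hs t h)
        simp [this]
      · simp [hs]
  have htot : ∑ t, ∑ s, C.indicator x s * (p s t).toReal = ∑ t, C.indicator x t := by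
    rw [Finset.sum_comm]
    refine Finset.sum_congr rfl fun s _ => ?_
    rw [← Finset.mul_sum, sum_toReal_eq_one, mul_one]
  -- A termwise inequality between vectors of equal total mass is an equality.
  exact (Finset.sum_eq_sum_iff_of_le hle).1 htot t (Finset.mem_univ t)

/-- An irreducible closed set carries at most one stationary distribution. -/
theorem IsStationary.eq_div {p : S → PMF S} {x y : S → ℝ} (hx : IsStationary p x)
    {C : Set S} (hC : IsClosedSet p C) (hirr : ∀ s ∈ C, ∀ t ∈ C, Reach p s t)
    (hpos : ∀ s ∈ C, x s ≠ 0) (hy : IsStationary p y) (hyC : ∀ s ∉ C, y s = 0) :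
    y = fun s => C.indicator x s / ∑ t, C.indicator x t := by
  classical
  have hne : C.Nonempty := by
    obtain ⟨s, hs⟩ := hy.exists_ne_zero
    exact ⟨s, by_contra fun h => hs (hyC s h)⟩
  have hpos' : ∀ s ∈ C, 0 < x s := fun s hs => (hx.nonneg s).lt_of_ne' (hpos s hs)
  -- With `c` the least ratio, `y - c x` on `C` is nonnegative, invariant and zero at `m`. Zeros
  -- propagate backwards along transitions, so irreducibility makes it vanish.
  obtain ⟨m, hmC, hm⟩ := Set.exists_min_image C (fun s => y s / x s) (Set.toFinite C) hne
  set c := y m / x m with hc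
  set z : S → ℝ := fun s => y s - c * C.indicator x s with hz
  have hznn : ∀ s, 0 ≤ z s := by
    intro s
    by_cases hs : s ∈ C
    · have := (le_div_iff₀ (hpos' s hs)).1 (hm s hs)
      simpa [hz, hs] using this
    · simp [hz, hs, hyC s hs]
  have hzinv : ∀ t, ∑ s, z s * (p s t).toReal = z t := by
    intro t
    simp only [hz, sub_mul, mul_assoc]
    rw [Finset.sum_sub_distrib, ← Finset.mul_sum, hy.invariant, hx.indicator_invariant hC]
  have hback : ∀ s t, p s t ≠ 0 → z t = 0 → z s = 0 := by
    intro s t hst ht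
    rw [← hzinv t, Finset.sum_eq_zero_iff_of_nonneg
      fun s _ => mul_nonneg (hznn s) ENNReal.toReal_nonneg] at ht
    exact (mul_eq_zero.1 (ht s (Finset.mem_univ s))).resolve_right
      (mt toReal_apply_eq_zero.1 hst)
  have hzm : z m = 0 := by
    simp only [hz, Set.indicator_of_mem hmC, hc]
    rw [div_mul_cancel₀ _ (hpos m hmC), sub_self]
  have hz0 : ∀ s, z s = 0 := by
    intro s
    by_cases hs : s ∈ C
    · induction hirr s hs m hmC using Relation.ReflTransGen.head_induction_on with
      | refl => exact hzm
      | head hst _ ih => exact hback _ _ hst (ih (hC _ hs _ hst))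
    · simp [hz, hs, hyC s hs]
  have hyx : ∀ s, y s = c * C.indicator x s := fun s => sub_eq_zero.1 (hz0 s)
  have hc1 : c * ∑ t, C.indicator x t = 1 := by
    rw [Finset.mul_sum, ← hy.sum_eq_one]
    exact Finset.sum_congr rfl fun s _ => (hyx s).symm
  funext s
  rw [hyx s, eq_div_iff (right_ne_zero_of_mul_eq_one hc1), mul_right_comm, hc1, one_mul]

/-- States that charge a stationary distribution are essential. -/
theorem IsStationary.reach_symm {p : S → PMF S} {x : S → ℝ} (hx : IsStationary p x) {s t : S}
    (hs : x s ≠ 0) (hst : Reach p s t) : Reach p t s := by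
  classical
  by_contra hts
  -- The part of `x` inside the closed set `N` reproduces itself, so no charged state outside `N`
  -- can send mass into `N`. Since `s` lies outside `N`, so does everything reachable from `s`.
  set N : Set S := {u | ¬ Reach p u s} with hN
  have hNc : IsClosedSet p N := isClosedSet_not_reach p s
  have hstep : ∀ u, x u ≠ 0 → u ∉ N → ∀ v, p u v ≠ 0 → v ∉ N := by
    intro u hu huN v huv hv
    have h := hx.indicator_invariant hNc v
    rw [Set.indicator_of_mem hv, ← hx.invariant v, Finset.sum_eq_sum_iff_of_le fun w _ =>
      mul_le_mul_of_nonneg_right (Set.indicator_le_self' (fun s _ => hx.nonneg s) w)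
        ENNReal.toReal_nonneg] at h
    have := h u (Finset.mem_univ u)
    rw [Set.indicator_of_notMem huN, zero_mul, eq_comm, mul_eq_zero] at this
    exact this.elim hu (mt toReal_apply_eq_zero.1 huv)
  have hcl : IsClosedSet p {u | x u ≠ 0 ∧ u ∉ N} := fun u hu v huv =>
    ⟨hx.ne_zero_of_step hu.1 huv, hstep u hu.1 hu.2 v huv⟩
  exact (hcl.mem_of_reach (x := s) ⟨hs, fun h => h .refl⟩ hst).2 hts

variable [MeasurableSpace S] [DiscreteMeasurableSpace S]

theorem IsStationary.missProb_eq_zero {p : S → PMF S} {x : S → ℝ} (hx : IsStationary p x) {s : S}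
    (hs : x s ≠ 0) : missProb p s s = 0 :=
  (isClosedSet_reach p s).missProb_eq_zero (fun _ ht => hx.reach_symm hs ht) .refl

theorem IsClosedSet.ae_typical {p : S → PMF S} {B : Set S} (hB : IsClosedSet p B) {s : S}
    (hs : s ∈ B) : ∀ᵐ ω ∂pathLaw p s, (∀ k, ω k ∈ B) ∧
      ∀ t, Tendsto (fun k : ℕ => compensatedVisits p t k ω / (k : ℝ)) atTop (𝓝 0) :=
  (hB.ae_mem hs).and (ae_all_iff.2 fun t => ae_tendsto_compensatedVisits_div p t s)

/-- Existence is read off a single typical trajectory: its visit frequencies have a cluster point in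
the compact simplex. -/
theorem IsClosedSet.exists_isStationary {p : S → PMF S} {B : Set S} (hB : IsClosedSet p B)
    {s : S} (hs : s ∈ B) : ∃ x, IsStationary p x ∧ ∀ t ∉ B, x t = 0 := by
  obtain ⟨ω, hω, hω'⟩ := (hB.ae_typical hs).exists
  have hle : map (visitFreq ω) atTop ≤ 𝓟 (stdSimplex ℝ S) := by
    refine le_principal_iff.2 (mem_map.2 ?_)
    filter_upwards [eventually_ge_atTop 1] with k hk
    exact visitFreq_mem_stdSimplex ω (by omega)
  obtain ⟨x, -, hx⟩ := isCompact_stdSimplex ℝ S hle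
  obtain ⟨U, hU, hx⟩ := mapClusterPt_iff_ultrafilter.1 hx
  exact ⟨x, isStationary_of_tendsto hω hω' hU hx⟩

/-- The ergodic theorem on an irreducible closed set. -/
theorem IsStationary.ae_tendsto_timeAverage {p : S → PMF S} {x : S → ℝ} (hx : IsStationary p x)
    {C : Set S} (hC : IsClosedSet p C) (hirr : ∀ s ∈ C, ∀ t ∈ C, Reach p s t)
    (hpos : ∀ s ∈ C, x s ≠ 0) {s₀ : S} (hs₀ : s₀ ∈ C) :
    ∀ᵐ ω ∂pathLaw p s₀, ∀ s, Tendsto (timeAverage s s₀ ω) atTop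
      (𝓝 (C.indicator x s / ∑ t, C.indicator x t)) := by
  filter_upwards [hC.ae_typical hs₀, ae_pathLaw_zero p s₀] with ω hω hω0 s
  have h := tendsto_visitFreq_of_unique hω.1 hω.2
    fun y hy hyC => hx.eq_div hC hirr hpos hy hyC
  exact (tendsto_pi_nhds.1 h s).congr fun k => (timeAverage_eq_visitFreq hω0 s k).symm

end Ergodic

/-! ### Maximal entropy forces maximal support. -/

section Entropy

variable {S U : Type*} [Fintype S] [Fintype U]

/-- The convex combination of two probability mass functions. -/
noncomputable def mixture {α : Type*} [Fintype α] (a b : ℝ≥0∞) (h : a + b = 1) (f g : PMF α) :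
    PMF α :=
  PMF.ofFintype (fun x => a * f x + b * g x) (by
    have hs : ∀ q : PMF α, ∑ x, q x = 1 := fun q => (tsum_fintype _).symm.trans q.tsum_coe
    rw [Finset.sum_add_distrib, ← Finset.mul_sum, ← Finset.mul_sum, hs, hs, mul_one, mul_one, h])

theorem marginal_mixture {a b : ℝ≥0∞} (h : a + b = 1) (f g : PMF (S × U)) (s : S) :
    marginal (mixture a b h f g) s = a * marginal f s + b * marginal g s := by
  simp [marginal, mixture, Finset.sum_add_distrib, Finset.mul_sum]

theorem mixture_mem_feasibleSet {Q : S → U → PMF S} {F : Set S} {f g : PMF (S × U)}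
    (hf : f ∈ feasibleSet Q F) (hg : g ∈ feasibleSet Q F) {a b : ℝ≥0∞} (h : a + b = 1) :
    mixture a b h f g ∈ feasibleSet Q F := by
  refine ⟨fun t => ?_, fun s hs => ?_⟩
  · rw [marginal_mixture, hf.1, hg.1]
    simp only [mixture, PMF.ofFintype_apply, mul_add, Finset.sum_add_distrib, Finset.mul_sum]
    simp only [mul_left_comm]
  · rw [marginal_mixture, hf.2 s hs, hg.2 s hs, mul_zero, mul_zero, add_zero]

theorem entropy_eq_sum_negMulLog (f : PMF (S × U)) :
    entropy f = ∑ x, Real.negMulLog (f x).toReal := by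
  rw [entropy, Fintype.sum_prod_type_right]
  simp [Real.negMulLog, Finset.sum_neg_distrib]

/-- Mixing in a distribution that charges a point of mass zero increases the entropy by an
amount of order `t log (1 / t)`. -/
theorem le_entropy_mixture {f g : PMF (S × U)} {x₀ : S × U} (hx₀ : f x₀ = 0) {t : ℝ}
    (ht0 : 0 ≤ t) (ht1 : t ≤ 1)
    (h : ENNReal.ofReal (1 - t) + ENNReal.ofReal t = 1) :
    (1 - t) * entropy f + t * entropy g + (g x₀).toReal * Real.negMulLog t ≤
      entropy (mixture _ _ h f g) := by
  classical
  have hval : ∀ x, (mixture _ _ h f g x).toReal = (1 - t) * (f x).toReal + t * (g x).toReal := by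
    intro x
    rw [mixture, PMF.ofFintype_apply, ENNReal.toReal_add
      (ENNReal.mul_ne_top ENNReal.ofReal_ne_top (f.apply_ne_top x))
      (ENNReal.mul_ne_top ENNReal.ofReal_ne_top (g.apply_ne_top x)), ENNReal.toReal_mul,
      ENNReal.toReal_mul, ENNReal.toReal_ofReal ht0, ENNReal.toReal_ofReal (by linarith)]
  have hterm : ∀ x ∈ Finset.univ, ((1 - t) * Real.negMulLog (f x).toReal +
      t * Real.negMulLog (g x).toReal +
      if x = x₀ then (g x₀).toReal * Real.negMulLog t else 0) ≤
        Real.negMulLog (mixture _ _ h f g x).toReal := by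
    intro x _
    rw [hval]
    split_ifs with hx
    · subst hx
      simp only [hx₀, ENNReal.toReal_zero, mul_zero, zero_add, Real.negMulLog_zero]
      -- At `x₀` the mixture equals `t * g x₀`, and the product rule yields the extra term exactly;
      -- at the other points concavity suffices.
      rw [Real.negMulLog_mul]
      linarith
    · rw [add_zero]
      exact Real.concaveOn_negMulLog.2 (Set.mem_Ici.2 ENNReal.toReal_nonneg)
        (Set.mem_Ici.2 ENNReal.toReal_nonneg) (by linarith) ht0 (by ring)
  have := Finset.sum_le_sum hterm
  rw [Finset.sum_add_distrib, Finset.sum_add_distrib, ← Finset.mul_sum, ← Finset.mul_sum,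
    Finset.sum_ite_eq' Finset.univ x₀ fun _ => (g x₀).toReal * Real.negMulLog t,
    if_pos (Finset.mem_univ x₀)] at this
  simpa only [entropy_eq_sum_negMulLog] using this

/-- The support of an optimal distribution contains the support of every feasible one. -/
theorem IsOptimal.ne_zero {Q : S → U → PMF S} {F : Set S} {f g : PMF (S × U)}
    (hf : IsOptimal Q F f) (hg : g ∈ feasibleSet Q F) {x : S × U} (hx : g x ≠ 0) : f x ≠ 0 := by
  intro hfx
  have hgx : 0 < (g x).toReal := ENNReal.toReal_nonneg.lt_of_ne' (mt toReal_apply_eq_zero.1 hx)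
  -- The choice of `t` makes the gain `g x * negMulLog t` equal to `t * d`, which exceeds the loss
  -- `t * (entropy f - entropy g)`.
  set d := |entropy f - entropy g| + 1 with hd
  have hd0 : 0 < d := by positivity
  set t := Real.exp (-(d / (g x).toReal)) with ht
  have ht0 : 0 < t := Real.exp_pos _
  have ht1 : t ≤ 1 := Real.exp_le_one_iff.2 (neg_nonpos.2 (by positivity))
  have h : ENNReal.ofReal (1 - t) + ENNReal.ofReal t = 1 := by
    rw [← ENNReal.ofReal_add (by linarith) ht0.le]
    simp
  have h1 := (le_entropy_mixture (g := g) hfx ht0.le ht1 h).trans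
    (hf.2 _ (mixture_mem_feasibleSet hf.1 hg h))
  have h2 : (g x).toReal * Real.negMulLog t = t * d := by
    rw [Real.negMulLog, ht, Real.log_exp]
    field_simp
  have h3 := le_abs_self (entropy f - entropy g)
  rw [h2] at h1
  nlinarith

end Entropy

/-! ### From feasible distributions to safe recurrent classes. -/

section Policy

variable {S U : Type*} [Fintype S] [Fintype U]

omit [Fintype S] in
theorem closedLoop_apply (Q : S → U → PMF S) (K : S → PMF U) (s t : S) :
    closedLoop Q K s t = ∑ u, K s u * Q s u t := by
  rw [closedLoop, PMF.bind_apply, tsum_fintype]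

omit [Fintype S] in
theorem marginal_mul_inducedPolicy (f : PMF (S × U)) (G : S → PMF U) (s : S) (u : U) :
    marginal f s * inducedPolicy f G s u = f (s, u) := by
  by_cases h : marginal f s = 0
  · rw [h, zero_mul]
    exact ((Finset.sum_eq_zero_iff.1 h) u (Finset.mem_univ u)).symm
  · rw [inducedPolicy_of_pos f G s (pos_iff_ne_zero.2 h),
      ENNReal.mul_div_cancel h (marginal_ne_top f s)]

theorem sum_marginal (f : PMF (S × U)) : ∑ s, marginal f s = 1 := by
  simp_rw [marginal]
  rw [← Fintype.sum_prod_type]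
  exact (tsum_fintype _).symm.trans f.tsum_coe

/-- Marginal times policy gives back `f` even where the marginal vanishes, so the feasibility
constraint is exactly stationarity, whatever `G` is. -/
theorem isStationary_marginal {Q : S → U → PMF S} {F : Set S} {f : PMF (S × U)}
    (hf : f ∈ feasibleSet Q F) (G : S → PMF U) :
    IsStationary (closedLoop Q (inducedPolicy f G)) fun s => (marginal f s).toReal where
  nonneg _ := ENNReal.toReal_nonneg
  sum_eq_one := by
    rw [← ENNReal.toReal_sum fun s _ => marginal_ne_top f s, sum_marginal, ENNReal.toReal_one]
  invariant t := by
    simp_rw [← ENNReal.toReal_mul]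
    rw [← ENNReal.toReal_sum fun s _ =>
      ENNReal.mul_ne_top (marginal_ne_top f s) (PMF.apply_ne_top _ t), hf.1 t]
    congr 1
    refine Finset.sum_congr rfl fun s _ => ?_
    rw [closedLoop_apply, Finset.mul_sum]
    refine Finset.sum_congr rfl fun u _ => ?_
    rw [← mul_assoc, marginal_mul_inducedPolicy, mul_comm]

/-- The law of the state-action pair when the state has the invariant distribution `y`. -/
noncomputable def stateActionLaw {p : S → PMF S} (K : S → PMF U) {y : S → ℝ}
    (hy : IsStationary p y) : PMF (S × U) :=
  PMF.ofFintype (fun x => ENNReal.ofReal (y x.1) * K x.1 x.2) (by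
    have hs : ∀ s, ∑ u, K s u = 1 := fun s => (tsum_fintype _).symm.trans (K s).tsum_coe
    rw [Fintype.sum_prod_type]
    simp only [← Finset.mul_sum, hs, mul_one]
    rw [← ENNReal.ofReal_sum_of_nonneg fun s _ => hy.nonneg s, hy.sum_eq_one, ENNReal.ofReal_one])

theorem marginal_stateActionLaw {p : S → PMF S} (K : S → PMF U) {y : S → ℝ}
    (hy : IsStationary p y) (s : S) : marginal (stateActionLaw K hy) s = ENNReal.ofReal (y s) := by
  have hs : ∑ u, K s u = 1 := (tsum_fintype _).symm.trans (K s).tsum_coe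
  simp [marginal, stateActionLaw, ← Finset.mul_sum, hs]

theorem stateActionLaw_mem_feasibleSet {Q : S → U → PMF S} {F : Set S} {K : S → PMF U} {y : S → ℝ}
    (hy : IsStationary (closedLoop Q K) y) (hF : ∀ s ∈ F, y s = 0) :
    stateActionLaw K hy ∈ feasibleSet Q F := by
  refine ⟨fun t => ?_, fun s hs => by rw [marginal_stateActionLaw, hF s hs, ENNReal.ofReal_zero]⟩
  rw [marginal_stateActionLaw, ← hy.invariant t, ENNReal.ofReal_sum_of_nonneg
    fun s _ => mul_nonneg (hy.nonneg s) ENNReal.toReal_nonneg]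
  refine Finset.sum_congr rfl fun s _ => ?_
  rw [ENNReal.ofReal_mul (hy.nonneg s), ENNReal.ofReal_toReal (PMF.apply_ne_top _ _),
    closedLoop_apply, Finset.mul_sum]
  refine Finset.sum_congr rfl fun u _ => ?_
  simp only [stateActionLaw, PMF.ofFintype_apply]
  ring

variable [MeasurableSpace S] [DiscreteMeasurableSpace S]

omit [Fintype S] [Fintype U] in
theorem mem_recurrentStates {Q : S → U → PMF S} {K : S → PMF U} {s : S} :
    s ∈ recurrentStates Q K ↔ missProb (closedLoop Q K) s s = 0 :=
  missProb_eq_zero.symm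

omit [Fintype U] in
/-- Every recurrent safe state carries an invariant distribution that avoids the forbidden set. -/
theorem exists_isStationary_of_mem_safeRecurrentStates {Q : S → U → PMF S} {F : Set S}
    {K : S → PMF U} {s : S} (hs : s ∈ safeRecurrentStates Q F K) :
    ∃ y, IsStationary (closedLoop Q K) y ∧ (∀ t ∈ F, y t = 0) ∧ y s ≠ 0 := by
  obtain ⟨hrec, hsafe⟩ := hs
  set p := closedLoop Q K with hp
  have hm : missProb p s s = 0 := mem_recurrentStates.1 hrec
  -- Safety only concerns positive times, but a recurrent state returns to itself.
  have hsF : s ∉ F := by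
    intro hsF
    have h1 : pathLaw p s {ω | ∃ k > 0, ω k = s} = 1 := hrec
    have h0 : pathLaw p s {ω | ∃ k > 0, ω k ∈ F} = 0 := hsafe
    have hle : pathLaw p s {ω | ∃ k > 0, ω k = s} ≤ pathLaw p s {ω | ∃ k > 0, ω k ∈ F} := by
      refine measure_mono ?_
      rintro ω ⟨k, hk, h⟩
      exact ⟨k, hk, h.symm ▸ hsF⟩
    rw [h0, h1] at hle
    exact one_ne_zero (le_zero_iff.1 hle)
  have hcl : IsClosedSet p {t | t ∉ F ∧ pathLaw p t {ω | ∃ k > 0, ω k ∈ F} = 0} :=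
    fun u hu v huv => hit_eq_zero_succ hu.2 huv
  obtain ⟨y, hy, hyB⟩ := (isClosedSet_reach p s).exists_isStationary (s := s) .refl
  refine ⟨y, hy, fun t ht => hyB t fun hst => ?_, ?_⟩
  · exact (hcl.mem_of_reach (x := s) ⟨hsF, hsafe⟩ hst).1 ht
  -- Some state reachable from `s` is charged. By recurrence it leads back to `s`, and the support
  -- of `y` is closed.
  · obtain ⟨z, hz⟩ := hy.exists_ne_zero
    have hsz : Reach p s z := by_contra fun h => hz (hyB z h)
    exact hy.isClosedSet_support.mem_of_reach hz
      (reach_of_missProb_eq_zero (missProb_eq_zero_of_reach hm hsz))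

theorem IsOptimal.marginal_ne_zero {Q : S → U → PMF S} {F : Set S} {f : PMF (S × U)}
    (hf : IsOptimal Q F f) {s : S} (hs : s ∈ maxSafeRecurrentStates Q F) : marginal f s ≠ 0 := by
  obtain ⟨K, hK⟩ := Set.mem_iUnion.1 hs
  obtain ⟨y, hy, hyF, hys⟩ := exists_isStationary_of_mem_safeRecurrentStates hK
  obtain ⟨u, hu⟩ := exists_step (K s)
  have hg : stateActionLaw K hy (s, u) ≠ 0 := by
    rw [stateActionLaw, PMF.ofFintype_apply]
    exact mul_ne_zero (ENNReal.ofReal_pos.2 ((hy.nonneg s).lt_of_ne' hys)).ne' hu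
  have hfu := hf.ne_zero (stateActionLaw_mem_feasibleSet hy hyF) hg
  exact fun h => hfu (Finset.sum_eq_zero_iff.1 h u (Finset.mem_univ u))

omit [Fintype S] [MeasurableSpace S] [DiscreteMeasurableSpace S] in
theorem toReal_marginal_ne_zero {f : PMF (S × U)} {s : S} :
    (marginal f s).toReal ≠ 0 ↔ marginal f s ≠ 0 := by
  simp [ENNReal.toReal_eq_zero_iff, marginal_ne_top f s]

theorem mem_safeRecurrentStates_of_marginal_ne_zero {Q : S → U → PMF S} {F : Set S}
    {f : PMF (S × U)} (hf : f ∈ feasibleSet Q F) (G : S → PMF U) {s : S} (hs : marginal f s ≠ 0) :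
    s ∈ safeRecurrentStates Q F (inducedPolicy f G) := by
  have hx := isStationary_marginal hf G
  have hs' := toReal_marginal_ne_zero.2 hs
  refine ⟨mem_recurrentStates.2 (hx.missProb_eq_zero hs'),
    hx.isClosedSet_support.hit_eq_zero (Set.disjoint_left.2 fun t ht htF => ht ?_) hs'⟩
  rw [hf.2 t htF, ENNReal.toReal_zero]

omit [Fintype S] [Fintype U] in
theorem safeRecurrentStates_subset (Q : S → U → PMF S) (F : Set S) (K : S → PMF U) :
    safeRecurrentStates Q F K ⊆ maxSafeRecurrentStates Q F :=
  Set.subset_iUnion (fun K => safeRecurrentStates Q F K) K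

omit [Fintype S] [Fintype U] in
theorem mem_safeSurveilledStates_self {Q : S → U → PMF S} {F : Set S} {K : S → PMF U} {s : S}
    (hs : s ∈ safeRecurrentStates Q F K) : s ∈ safeSurveilledStates Q F K s :=
  ⟨⟨hs.1, hs.1⟩, hs.2⟩

/-- The recurrent class of `s` consists of the states that can be reached from `s`. -/
theorem safeSurveilledStates_eq_reach {Q : S → U → PMF S} {F : Set S}
    {f : PMF (S × U)} (hf : f ∈ feasibleSet Q F) (G : S → PMF U) {s : S} (hs : marginal f s ≠ 0) :
    safeSurveilledStates Q F (inducedPolicy f G) s =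
      {t | Reach (closedLoop Q (inducedPolicy f G)) s t} := by
  have hx := isStationary_marginal hf G
  have hs' := toReal_marginal_ne_zero.2 hs
  ext t
  constructor
  · rintro ⟨⟨-, h⟩, -⟩
    exact reach_of_missProb_eq_zero (missProb_eq_zero.2 h)
  · intro hst
    have ht := mem_safeRecurrentStates_of_marginal_ne_zero hf G
      (toReal_marginal_ne_zero.1 (hx.isClosedSet_support.mem_of_reach hs' hst))
    refine ⟨⟨ht.1, missProb_eq_zero.1 ?_⟩, ht.2⟩
    exact (isClosedSet_reach _ s).missProb_eq_zero
      (fun u hu => (hx.reach_symm hs' hu).trans hst) .refl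

theorem IsOptimal.ae_tendsto_timeAverage {Q : S → U → PMF S} {F : Set S} {f : PMF (S × U)}
    (hf : IsOptimal Q F f) (G : S → PMF U) {C : Set S}
    (hC : C ∈ safeRecurrentClasses Q F (inducedPolicy f G)) {s₀ : S} (hs₀ : s₀ ∈ C) :
    0 < mass f C ∧ ∀ᵐ ω ∂pathLaw (closedLoop Q (inducedPolicy f G)) s₀, ∀ s,
      Tendsto (timeAverage s s₀ ω) atTop
        (𝓝 (C.indicator (fun t => (marginal f t).toReal) s / (mass f C).toReal)) := by
  obtain ⟨s₁, hs₁, rfl⟩ := hC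
  have hm₁ := hf.marginal_ne_zero (safeRecurrentStates_subset Q F _ hs₁)
  have hx := isStationary_marginal hf.1 G
  have hm₁' := toReal_marginal_ne_zero.2 hm₁
  rw [safeSurveilledStates_eq_reach hf.1 G hm₁] at hs₀ ⊢
  set p := closedLoop Q (inducedPolicy f G)
  have hpos : ∀ s ∈ {t | Reach p s₁ t}, (marginal f s).toReal ≠ 0 := fun s hs =>
    hx.isClosedSet_support.mem_of_reach hm₁' hs
  have hmass : (mass f {t | Reach p s₁ t}).toReal =
      ∑ s, Set.indicator {t | Reach p s₁ t} (fun t => (marginal f t).toReal) s := by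
    classical
    rw [mass, ENNReal.toReal_sum]
    · refine Finset.sum_congr rfl fun s _ => ?_
      simp only [Set.indicator_apply]
      split_ifs <;> simp
    · intro s _
      simp only [Set.indicator_apply]
      split_ifs
      · exact marginal_ne_top f s
      · exact ENNReal.zero_ne_top
  refine ⟨?_, ?_⟩
  · refine pos_iff_ne_zero.2 fun h => ?_
    have h0 := Finset.sum_eq_zero_iff.1 h s₀ (Finset.mem_univ s₀)
    rw [Set.indicator_of_mem hs₀] at h0
    exact toReal_marginal_ne_zero.1 (hpos s₀ hs₀) h0
  · rw [hmass]
    exact hx.ae_tendsto_timeAverage (isClosedSet_reach p s₁)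
      (fun s hs t ht => (hx.reach_symm hm₁' hs).trans ht) hpos hs₀

end Policy

end Surveillance

theorem mainTheorem3 {S U : Type*} [Fintype S] [Fintype U]
    [MeasurableSpace S] [DiscreteMeasurableSpace S]
    (Q : S → U → PMF S) (F : Set S) (f : PMF (S × U)) (hf : Surveillance.IsOptimal Q F f)
    (G K : S → PMF U) (hK : K = Surveillance.inducedPolicy f G) :
    -- one recurrent class
    ((Surveillance.safeRecurrentClasses Q F K).ncard = 1 →
      ∀ s₀ ∈ Surveillance.maxSafeRecurrentStates Q F,
        ∀ᵐ ω ∂(Surveillance.pathLaw (Surveillance.closedLoop Q K) s₀), ∀ s : S,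
          Tendsto (Surveillance.timeAverage s s₀ ω) atTop
            (𝓝 (Surveillance.marginal f s).toReal)) ∧
    -- any number of recurrent classes
    (∀ s₀ ∈ Surveillance.maxSafeRecurrentStates Q F,
      ∃ C ∈ Surveillance.safeRecurrentClasses Q F K, s₀ ∈ C) ∧
    (∀ C ∈ Surveillance.safeRecurrentClasses Q F K, ∀ s₀ ∈ C,
      0 < Surveillance.mass f C ∧
      ∀ᵐ ω ∂(Surveillance.pathLaw (Surveillance.closedLoop Q K) s₀), ∀ s : S,
        (s ∈ C → Tendsto (Surveillance.timeAverage s s₀ ω) atTop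
          (𝓝 ((Surveillance.marginal f s).toReal / (Surveillance.mass f C).toReal))) ∧
        (s ∉ C → Tendsto (Surveillance.timeAverage s s₀ ω) atTop (𝓝 0))) := by
  subst hK
  have hmem : ∀ s₀ ∈ Surveillance.maxSafeRecurrentStates Q F,
      s₀ ∈ Surveillance.safeRecurrentStates Q F (Surveillance.inducedPolicy f G) := fun s₀ hs₀ =>
    Surveillance.mem_safeRecurrentStates_of_marginal_ne_zero hf.1 G (hf.marginal_ne_zero hs₀)
  refine ⟨fun hone s₀ hs₀ => ?_, fun s₀ hs₀ => ⟨_, ⟨s₀, hmem s₀ hs₀, rfl⟩,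
    Surveillance.mem_safeSurveilledStates_self (hmem s₀ hs₀)⟩, fun C hC s₀ hs₀ => ?_⟩
  · obtain ⟨C, hC⟩ := Set.ncard_eq_one.1 hone
    have hcls : ∀ s ∈ Surveillance.safeRecurrentStates Q F (Surveillance.inducedPolicy f G),
        s ∈ C := by
      intro s hs
      have h : Surveillance.safeSurveilledStates Q F (Surveillance.inducedPolicy f G) s ∈
          Surveillance.safeRecurrentClasses Q F (Surveillance.inducedPolicy f G) := ⟨s, hs, rfl⟩
      rw [hC, Set.mem_singleton_iff] at h
      exact h ▸ Surveillance.mem_safeSurveilledStates_self hs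
    -- Every charged state is safe recurrent and so lies in the only class; hence the class has mass
    -- `1`.
    have hind : ∀ s ∉ C, Surveillance.marginal f s = 0 := fun s hs => by_contra fun h =>
      hs (hcls s (Surveillance.mem_safeRecurrentStates_of_marginal_ne_zero hf.1 G h))
    have hmass : Surveillance.mass f C = 1 := by
      rw [← Surveillance.sum_marginal f, Surveillance.mass]
      refine Finset.sum_congr rfl fun s _ => ?_
      by_cases hs : s ∈ C <;> simp [hs, hind]
    filter_upwards [(hf.ae_tendsto_timeAverage G (C := C) (by rw [hC]; rfl)
      (hcls s₀ (hmem s₀ hs₀))).2] with ω hω s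
    have h := hω s
    rw [hmass, ENNReal.toReal_one, div_one] at h
    by_cases hs : s ∈ C
    · rwa [Set.indicator_of_mem hs] at h
    · rwa [Set.indicator_of_notMem hs, ← ENNReal.toReal_zero, ← hind s hs] at h
  · obtain ⟨hpos, hlim⟩ := hf.ae_tendsto_timeAverage G hC hs₀
    refine ⟨hpos, ?_⟩
    filter_upwards [hlim] with ω hω s
    have h := hω s
    refine ⟨fun hs => ?_, fun hs => ?_⟩
    · rwa [Set.indicator_of_mem hs] at h
    · rwa [Set.indicator_of_notMem hs, zero_div] at h
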